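/- Throughout, let $(\Omega,\nu)$ be an atomless standard Borel probability space and let $W:\Omega\times\Omega\to[0,1]$ be a graphon, i.e. a symmetric measurable function. A measurable set $A\subseteq\Omega$ is *independent* in $W$ if $W=0$ almost everywhere on $A\times A$. The chromatic number $\chi(W)\in\mathbb N\cup\{\infty\}$ is the least $k$ for which there is a measurable $f:\Omega\to\{1,\dots,k\}$ such that $f^{-1}(i)$ is independent in $W$ for every $i$ (and $\chi(W)=\infty$ if there is no such $k$). A graphon $U$ on $\Omega$ is a *representation* of a finite graph $H$ if there is a partition $\Omega=\bigsqcup_{v\in V(H)}\Omega_v$ into measurable sets of measure $1/|V(H)|$ such that, up to null sets, $U=1$ on $\Omega_u\times\Omega_v$ if $uv\in E(H)$ and $U=0$ on $\Omega_u\times\Omega_v$ if $uv\notin E(H)$. The cut-distance of graphons $U,W$ is $\delta_\square(U,W)=\inf_{\varphi}\sup_{S,T}\left|\int_{S\times T}\bigl(U(\varphi(x),\varphi(y))-W(x,y)\bigr)\,d\nu^{\otimes2}(x,y)\right|$, with $\varphi$ ranging over the invertible measure-preserving maps $\Omega\to\Omega$ and $S,T$ over the measurable subsets of $\Omega$. A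 sequence of finite graphs $H_n$ converges to $W$ in the cut-distance if $\delta_\square(U_n,W)\to0$ for graphon representations $U_n$ of $H_n$. The $W$-random graph $\mathbb G(n,W)$ has $n$ vertices; one samples independent points $x_1,\dots,x_n$ with law $\nu$ and then, independently for all pairs $i<j$, joins $i$ and $j$ by an edge with probability $W(x_i,x_j)$. **Theorem 4.2.** (a) For every sequence of finite graphs $(H_n)$ that converges to $W$ in the cut-distance, $\chi(W)\le\liminf_{n\to\infty}\chi(H_n)$. (b) Let $G_1,G_2,\dots$ be random graphs on a common probability space, with any joint distribution, such that $G_n\sim\mathbb G(n,W)$ for every $n$. Then almost surely $\lim_{n\to\infty}\chi(G_n)=\chi(W)$ (in $\mathbb N\cup\{\infty\}$). -/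

import Mathlib

open MeasureTheory ProbabilityTheory Filter Topology

/-- A graphon on the measurable space `Ω`: a symmetric measurable function `Ω × Ω → [0,1]`. -/
structure Graphon (Ω : Type*) [MeasurableSpace Ω] where
  /-- the underlying function -/
  toFun : Ω → Ω → ℝ
  measurable' : Measurable (Function.uncurry toFun)
  symm' : ∀ x y, toFun x y = toFun y x
  nonneg' : ∀ x y, 0 ≤ toFun x y
  le_one' : ∀ x y, toFun x y ≤ 1

namespace Graphon

section Basic

variable {Ω : Type*} [MeasurableSpace Ω]

instance : CoeFun (Graphon Ω) (fun _ => Ω → Ω → ℝ) := ⟨Graphon.toFun⟩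

/-- `W ^ φ`, i.e. `(x, y) ↦ W (φ x) (φ y)`, for a measurable automorphism `φ` of `Ω`. -/
def relabel (W : Graphon Ω) (φ : Ω ≃ᵐ Ω) : Graphon Ω where
  toFun x y := W (φ x) (φ y)
  measurable' := W.measurable'.comp
    ((φ.measurable.comp measurable_fst).prodMk (φ.measurable.comp measurable_snd))
  symm' _ _ := W.symm' _ _
  nonneg' _ _ := W.nonneg' _ _
  le_one' _ _ := W.le_one' _ _

/-- A set `A` is independent in `W` if `W` is zero almost everywhere on `A × A`. -/
def IsIndependent (ν : Measure Ω) (W : Graphon Ω) (A : Set Ω) : Prop :=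
  MeasurableSet A ∧ ∀ᵐ z ∂((ν.prod ν).restrict (A ×ˢ A)), W z.1 z.2 = 0

/-- A proper coloring of `W` with `k` colors: a measurable function `f : Ω → [k]` all of whose
color classes are independent sets in `W`. -/
def IsProperColoring (ν : Measure Ω) (W : Graphon Ω) (k : ℕ) (f : Ω → Fin k) : Prop :=
  Measurable f ∧ ∀ i, W.IsIndependent ν (f ⁻¹' {i})

/-- The chromatic number of `W`: the least number of colors in a proper coloring, and `⊤` if
there is no proper coloring. -/
noncomputable def chromaticNumber (ν : Measure Ω) (W : Graphon Ω) : ℕ∞ :=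
  sInf {c : ℕ∞ | ∃ k : ℕ, (∃ f : Ω → Fin k, W.IsProperColoring ν k f) ∧ c = (k : ℕ∞)}

/-- The cut-norm `sup_{S, T} |∫_{S × T} D|` of a function `D` on `Ω × Ω`, the supremum being over
measurable sets. (For a bounded `D` and a finite `ν`, the set below is nonempty and bounded.) -/
noncomputable def cutNorm (ν : Measure Ω) (D : Ω → Ω → ℝ) : ℝ :=
  sSup {r : ℝ | ∃ S T : Set Ω, MeasurableSet S ∧ MeasurableSet T ∧
    r = |∫ z in S ×ˢ T, D z.1 z.2 ∂(ν.prod ν)|}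

/-- The cut-distance `inf_φ ‖U ^ φ - W‖` in the cut-norm, the infimum being over invertible
measure-preserving maps `φ : Ω → Ω`. -/
noncomputable def cutDist (ν : Measure Ω) (U W : Graphon Ω) : ℝ :=
  sInf {r : ℝ | ∃ φ : Ω ≃ᵐ Ω, MeasurePreserving φ ν ν ∧
    r = cutNorm ν (fun x y => U.relabel φ x y - W x y)}

/-- `U` is a graphon representation of the finite graph `H`: there is a partition of `Ω` into sets
`P v`, `v ∈ V(H)`, of measure `1 / |V(H)|`, such that `U` is almost everywhere `1` on
`P u × P v` if `uv` is an edge, and almost everywhere `0` on it otherwise. -/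
def Represents (ν : Measure Ω) (U : Graphon Ω) {V : Type*} [Fintype V] (H : SimpleGraph V) :
    Prop :=
  ∃ P : V → Set Ω,
    (∀ v, MeasurableSet (P v)) ∧ Pairwise (fun u v => Disjoint (P u) (P v)) ∧
    (⋃ v, P v) = Set.univ ∧ (∀ v, ν (P v) = (Fintype.card V : ENNReal)⁻¹) ∧
    ∀ u v,
      (H.Adj u v → ∀ᵐ z ∂((ν.prod ν).restrict (P u ×ˢ P v)), U z.1 z.2 = 1) ∧
      (¬ H.Adj u v → ∀ᵐ z ∂((ν.prod ν).restrict (P u ×ˢ P v)), U z.1 z.2 = 0)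

end Basic

section RandomGraph

variable {Ω : Type*} [MeasurableSpace Ω]

/-- The graph on `{0, …, n-1}` in which distinct `i, j` are adjacent iff `t_{ij} < W (x i) (x j)`.
For a uniform `t_{ij} ∈ [0,1]`, this happens with probability `W (x i) (x j)`. -/
def sampleGraph (W : Graphon Ω) {n : ℕ} (x : Fin n → Ω) (t : Sym2 (Fin n) → unitInterval) :
    SimpleGraph (Fin n) where
  Adj i j := i ≠ j ∧ (t s(i, j) : ℝ) < W (x i) (x j)
  symm := ⟨fun i j h => ⟨h.1.symm, by rw [Sym2.eq_swap, W.symm']; exact h.2⟩⟩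
  loopless := ⟨fun _ h => h.1 rfl⟩

theorem measurable_sampleGraph (W : Graphon Ω) (n : ℕ) :
    Measurable (fun p : (Fin n → Ω) × (Sym2 (Fin n) → unitInterval) =>
      W.sampleGraph p.1 p.2) := by
  rw [SimpleGraph.measurable_iff_adj]
  intro i j
  have h1 : Measurable (fun p : (Fin n → Ω) × (Sym2 (Fin n) → unitInterval) =>
      W (p.1 i) (p.1 j)) :=
    W.measurable'.comp (g := Function.uncurry W.toFun)
      (f := fun p : (Fin n → Ω) × (Sym2 (Fin n) → unitInterval) => (p.1 i, p.1 j))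
      (((measurable_pi_apply i).comp measurable_fst).prodMk
        ((measurable_pi_apply j).comp measurable_fst))
  have h2 : Measurable (fun p : (Fin n → Ω) × (Sym2 (Fin n) → unitInterval) =>
      ((p.2 s(i, j) : unitInterval) : ℝ)) :=
    measurable_subtype_coe.comp ((measurable_pi_apply _).comp measurable_snd)
  exact Measurable.and measurable_const (measurableSet_setOfPred.1 (measurableSet_lt h2 h1))

/-- The law of the `W`-random graph `𝔾(n, W)`: sample independent points `x_i` with law `ν`, and
then, independently for all pairs, connect `i ≠ j` with probability `W (x_i) (x_j)`. -/
noncomputable def randomGraphLaw (ν : Measure Ω) (W : Graphon Ω) (n : ℕ) :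
    Measure (SimpleGraph (Fin n)) :=
  ((Measure.pi fun _ : Fin n => ν).prod
    (Measure.pi fun _ : Sym2 (Fin n) => (volume : Measure unitInterval))).map
      (fun p => W.sampleGraph p.1 p.2)

instance (ν : Measure Ω) [IsProbabilityMeasure ν] (W : Graphon Ω) (n : ℕ) :
    IsProbabilityMeasure (W.randomGraphLaw ν n) :=
  Measure.isProbabilityMeasure_map (W.measurable_sampleGraph n).aemeasurable

end RandomGraph

end Graphon

/-! Measurability of colorings can be ignored: if a color class `C` carries no mass of `W` up to a
null set of pairs, neither does its measurable hull. So any coloring proper off a null set of pairs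
can be made measurable (`exists_isProperColoring_of_ae`), and colorings may come from
nonconstructive compactness.

(a) If infinitely many `H n` are `k`-colorable, their colorings transfer to relabeled
representations, and closeness in cut-norm makes the `W`-mass inside color classes arbitrarily
small. With errors `2⁻ⁿ`, Borel-Cantelli shows that almost every pair with `W ≠ 0` is monochromatic
only finitely often, so the pointwise ultrafilter limit of the colorings is proper almost everywhere
(`exists_isProperColoring_of_approx`).

(b) A proper coloring of `W` colors every sample, which gives the upper bound. For the lower bound,
suppose that all samples are almost surely `k`-colorable. Join two points of `Ω` if `{W > 0}` has
density 1 there. A finite subgraph is `k`-colorable: random points in tiny balls around its vertices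
reproduce all its edges with positive probability. De Bruijn-Erdős colors all of `Ω`, and by
Lebesgue density the coloring is proper almost everywhere
(`exists_isProperColoring_of_ae_colorable`). Hence for `k < χ(W)` some size `m` has colorability
probability `q < 1`; disjoint blocks give at most `q ^ (n / m)` for size `n`, and Borel-Cantelli
finishes without any independence between different `n`. -/

namespace Graphon

/-! ### Colorings up to null sets, and limits of colorings. -/

section Colorings

variable {Ω : Type*} [MeasurableSpace Ω] {ν : Measure Ω} {W : Graphon Ω}

theorem measurable_uncurry (W : Graphon Ω) : Measurable fun z : Ω × Ω => W z.1 z.2 :=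
  W.measurable'

theorem IsIndependent.mono {A B : Set Ω} (hA : W.IsIndependent ν A) (hB : MeasurableSet B)
    (hBA : B ⊆ A) : W.IsIndependent ν B :=
  ⟨hB, ae_restrict_of_ae_restrict_of_subset (Set.prod_mono hBA hBA) hA.2⟩

/-- The measurable hull of a set `C` on which `W` vanishes, up to a null set of pairs, is
independent. The set `C` need not be measurable. -/
theorem isIndependent_toMeasurable [IsFiniteMeasure ν] {C : Set Ω}
    (h : ∀ᵐ z ∂ν.prod ν, z.1 ∈ C → z.2 ∈ C → W z.1 z.2 = 0) :
    W.IsIndependent ν (toMeasurable ν C) := by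
  have hM : MeasurableSet (toMeasurable ν C) := measurableSet_toMeasurable ν C
  refine ⟨hM, ?_⟩
  obtain ⟨N, hsub, hN, hN0⟩ := exists_measurable_superset_of_null (ae_iff.1 h)
  set Q : Set (Ω × Ω) := {z | ¬ W z.1 z.2 = 0} \ N with hQdef
  have hQ : MeasurableSet Q :=
    ((W.measurable_uncurry (measurableSet_singleton 0)).compl).diff hN
  have hQC : ∀ x ∈ C, ∀ y ∈ C, (x, y) ∉ Q := by
    rintro x hx y hy ⟨h1, h2⟩
    exact h2 (hsub fun h3 => h1 (h3 hx hy))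
  -- A measurable set meets the hull in the same measure as it meets `C`. This is used twice: on the
  -- rows of `Q` over `C`, then on the set `D` of rows that are not null.
  have hrow : ∀ x ∈ C, ν (Prod.mk x ⁻¹' Q ∩ toMeasurable ν C) = 0 := by
    intro x hx
    rw [Set.inter_comm, Measure.measure_toMeasurable_inter (measurable_prodMk_left hQ)
      (measure_ne_top ν C)]
    convert measure_empty (μ := ν)
    ext y
    simp only [Set.mem_inter_iff, Set.mem_preimage, Set.mem_empty_iff_false, iff_false, not_and]
    exact fun hy => hQC x hx y hy
  set D : Set Ω := {x | (ν.restrict (toMeasurable ν C)) (Prod.mk x ⁻¹' Q) ≠ 0} with hD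
  have hDm : MeasurableSet D :=
    (measurable_measure_prodMk_left hQ (measurableSet_singleton 0)).compl
  have hD0 : ν (toMeasurable ν C ∩ D) = 0 := by
    rw [Measure.measure_toMeasurable_inter hDm (measure_ne_top ν C)]
    convert measure_empty (μ := ν)
    ext x
    simp only [Set.mem_inter_iff, Set.mem_empty_iff_false, iff_false, not_and, hD,
      Set.mem_ofPred_eq, not_not]
    intro hx
    rw [Measure.restrict_apply (measurable_prodMk_left hQ)]
    exact hrow x hx
  have hQ0 : ((ν.prod ν).restrict (toMeasurable ν C ×ˢ toMeasurable ν C)) Q = 0 := by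
    rw [← Measure.prod_restrict, Measure.measure_prod_null hQ]
    change ∀ᵐ x ∂ν.restrict (toMeasurable ν C), _ = _
    rw [ae_iff, Measure.restrict_apply' hM, Set.inter_comm]
    exact hD0
  have hN0' : ((ν.prod ν).restrict (toMeasurable ν C ×ˢ toMeasurable ν C)) N = 0 :=
    Measure.absolutelyContinuous_of_le Measure.restrict_le_self hN0
  refine measure_mono_null (fun z hz => ?_) (measure_union_null hQ0 hN0')
  by_cases hzN : z ∈ N
  · exact Or.inr hzN
  · exact Or.inl ⟨hz, hzN⟩

/-- A cover of `Ω` by `k` independent sets yields a proper coloring. -/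
theorem exists_isProperColoring_of_cover {k : ℕ} (M : Fin k → Set Ω)
    (hM : ∀ i, W.IsIndependent ν (M i)) (hcov : ∀ x, ∃ i, x ∈ M i) :
    ∃ f : Ω → Fin k, W.IsProperColoring ν k f := by
  classical
  have hmin : ∀ x, ∃ i, x ∈ M i ∧ ∀ j < i, x ∉ M j := by
    intro x
    obtain ⟨i, hi, hmin⟩ := WellFounded.has_min (wellFounded_lt (α := Fin k))
      {i | x ∈ M i} (hcov x)
    exact ⟨i, hi, fun j hj hxj => hmin j hxj hj⟩
  choose f hf hf' using hmin
  have hpre : ∀ i, f ⁻¹' {i} = M i \ ⋃ j ∈ Set.Iio i, M j := by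
    intro i
    ext x
    simp only [Set.mem_preimage, Set.mem_singleton_iff, Set.mem_sdiff, Set.mem_iUnion,
      Set.mem_Iio, not_exists]
    constructor
    · rintro rfl
      exact ⟨hf x, hf' x⟩
    · rintro ⟨h1, h2⟩
      rcases lt_trichotomy (f x) i with h | h | h
      · exact absurd (hf x) (h2 _ h)
      · exact h
      · exact absurd h1 (hf' x i h)
  have hmeas : ∀ i, MeasurableSet (f ⁻¹' {i}) := by
    intro i
    rw [hpre]
    exact (hM i).1.diff (MeasurableSet.biUnion (Set.to_countable _) fun j _ => (hM j).1)
  refine ⟨f, measurable_to_countable' hmeas, fun i => (hM i).mono (hmeas i) ?_⟩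
  rw [hpre]
  exact Set.sdiff_subset

/-- A not necessarily measurable coloring, proper up to a null set of pairs, can be replaced by a
measurable one. -/
theorem exists_isProperColoring_of_ae [IsFiniteMeasure ν] {k : ℕ} (c : Ω → Fin k)
    (h : ∀ᵐ z ∂ν.prod ν, c z.1 = c z.2 → W z.1 z.2 = 0) :
    ∃ f : Ω → Fin k, W.IsProperColoring ν k f := by
  refine exists_isProperColoring_of_cover (fun i => toMeasurable ν (c ⁻¹' {i})) (fun i => ?_)
    fun x => ⟨c x, subset_toMeasurable ν _ rfl⟩
  refine isIndependent_toMeasurable ?_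
  filter_upwards [h] with z hz h1 h2
  exact hz (h1.trans h2.symm)

theorem IsProperColoring.ae {k : ℕ} {f : Ω → Fin k} (hf : W.IsProperColoring ν k f) :
    ∀ᵐ z ∂ν.prod ν, f z.1 = f z.2 → W z.1 z.2 = 0 := by
  have h : ∀ i, ∀ᵐ z ∂ν.prod ν, z ∈ (f ⁻¹' {i}) ×ˢ (f ⁻¹' {i}) → W z.1 z.2 = 0 := fun i =>
    (ae_restrict_iff' ((hf.2 i).1.prod (hf.2 i).1)).1 (hf.2 i).2
  filter_upwards [ae_all_iff.2 h] with z hz hfz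
  exact hz (f z.2) ⟨hfz, rfl⟩

theorem chromaticNumber_le {k : ℕ} {f : Ω → Fin k} (hf : W.IsProperColoring ν k f) :
    W.chromaticNumber ν ≤ k :=
  sInf_le ⟨k, ⟨f, hf⟩, rfl⟩

theorem exists_isProperColoring_of_ne_top (h : W.chromaticNumber ν ≠ ⊤) :
    ∃ (k : ℕ) (f : Ω → Fin k), W.IsProperColoring ν k f ∧ W.chromaticNumber ν = k := by
  have hne : {c : ℕ∞ | ∃ k : ℕ, (∃ f : Ω → Fin k, W.IsProperColoring ν k f) ∧
      c = (k : ℕ∞)}.Nonempty := by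
    rw [Set.nonempty_iff_ne_empty]
    intro h0
    exact h (by rw [chromaticNumber, h0, sInf_empty])
  obtain ⟨k, ⟨f, hf⟩, hk⟩ := csInf_mem hne
  exact ⟨k, f, hf, hk⟩

/-- If there are measurable `k`-colorings whose color classes span arbitrarily small mass of `W`,
then `W` has a proper `k`-coloring. -/
theorem exists_isProperColoring_of_approx [IsFiniteMeasure ν] {k : ℕ}
    (h : ∀ δ : ℝ, 0 < δ → ∃ f : Ω → Fin k, Measurable f ∧
      ∀ i, ∫ z in (f ⁻¹' {i}) ×ˢ (f ⁻¹' {i}), W z.1 z.2 ∂(ν.prod ν) ≤ δ) :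
    ∃ f : Ω → Fin k, W.IsProperColoring ν k f := by
  choose f hfm hf using fun n : ℕ => h ((1 / 2 : ℝ) ^ n) (by positivity)
  have hint : Integrable (fun z : Ω × Ω => W z.1 z.2) (ν.prod ν) :=
    Integrable.of_bound (C := 1) W.measurable_uncurry.aestronglyMeasurable
      (ae_of_all _ fun z => by
        rw [Real.norm_eq_abs, abs_of_nonneg (W.nonneg' _ _)]; exact W.le_one' _ _)
  set B : ℕ → Fin k → Set (Ω × Ω) := fun n i => (f n ⁻¹' {i}) ×ˢ (f n ⁻¹' {i}) with hB
  have hBm : ∀ n i, MeasurableSet (B n i) := fun n i =>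
    (hfm n (measurableSet_singleton i)).prod (hfm n (measurableSet_singleton i))
  have hsum : ∀ i, ∀ᵐ z ∂ν.prod ν, W z.1 z.2 ≠ 0 → ∀ᶠ n in atTop, z ∉ B n i := by
    intro i
    have hWm : Measurable fun z : Ω × Ω => ENNReal.ofReal (W z.1 z.2) :=
      W.measurable_uncurry.ennreal_ofReal
    -- Borel-Cantelli is applied to the measure with density `W`, which sees only pairs with `W ≠
    -- 0`.
    have hfin : ∑' n, ((ν.prod ν).withDensity fun z => ENNReal.ofReal (W z.1 z.2)) (B n i) ≠ ⊤ := by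
      refine ne_top_of_le_ne_top (b := ∑' n : ℕ, ENNReal.ofReal ((1 / 2 : ℝ) ^ n)) ?_
        (ENNReal.tsum_le_tsum fun n => ?_)
      · rw [← ENNReal.ofReal_tsum_of_nonneg (fun n => by positivity)
          (summable_geometric_of_lt_one (by norm_num) (by norm_num))]
        exact ENNReal.ofReal_ne_top
      · rw [withDensity_apply _ (hBm n i), ← ofReal_integral_eq_lintegral_ofReal
          hint.integrableOn (ae_of_all _ fun z => W.nonneg' _ _)]
        exact ENNReal.ofReal_le_ofReal (hf n i)
    have hae := ae_eventually_notMem hfin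
    rw [ae_withDensity_iff hWm] at hae
    filter_upwards [hae] with z hz hW
    refine hz ?_
    rw [Ne, ENNReal.ofReal_eq_zero, not_le]
    exact lt_of_le_of_ne (W.nonneg' _ _) (Ne.symm hW)
  -- With finitely many colors, an ultrafilter selects exactly one at each point; the limit need not
  -- be measurable.
  have hlim : ∀ x : Ω, ∃ i : Fin k, ∀ᶠ n in (hyperfilter ℕ : Filter ℕ), f n x = i := by
    intro x
    have : ∀ᶠ n in (hyperfilter ℕ : Filter ℕ), ∃ i ∈ (Set.univ : Set (Fin k)), f n x = i :=
      Eventually.of_forall fun n => ⟨_, trivial, rfl⟩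
    rw [Ultrafilter.eventually_exists_mem_iff Set.finite_univ] at this
    simpa using this
  choose c hc using hlim
  refine exists_isProperColoring_of_ae c ?_
  filter_upwards [ae_all_iff.2 hsum] with z hz hcz
  by_contra hW
  have h1 : ∀ᶠ n in (hyperfilter ℕ : Filter ℕ), z ∉ B n (c z.2) :=
    (Nat.cofinite_eq_atTop ▸ hyperfilter_le_cofinite :
      (hyperfilter ℕ : Filter ℕ) ≤ atTop) (hz (c z.2) hW)
  obtain ⟨n, hn, hn1, hn2⟩ := (h1.and ((hc z.1).and (hc z.2))).exists
  exact hn ⟨hn1.trans hcz, hn2⟩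

end Colorings

/-! ### Cut-distance and part (a). -/

section CutDistance

variable {Ω : Type*} [MeasurableSpace Ω] {ν : Measure Ω}

theorem abs_setIntegral_sub_le_cutNorm [IsProbabilityMeasure ν] (U W : Graphon Ω) {S T : Set Ω}
    (hS : MeasurableSet S) (hT : MeasurableSet T) :
    |∫ z in S ×ˢ T, (U z.1 z.2 - W z.1 z.2) ∂(ν.prod ν)| ≤
      cutNorm ν (fun x y => U x y - W x y) := by
  -- The bound 1 makes the real supremum meaningful: `|U - W| ≤ 1` on a probability space.
  refine le_csSup ⟨1, ?_⟩ ⟨S, T, hS, hT, rfl⟩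
  rintro _ ⟨S, T, -, -, rfl⟩
  refine (norm_setIntegral_le_of_norm_le_const (μ := ν.prod ν) (s := S ×ˢ T) (C := 1)
    (f := fun z => U z.1 z.2 - W z.1 z.2) (measure_lt_top _ _) (fun z _ => ?_)).trans ?_
  · rw [Real.norm_eq_abs, abs_le]
    constructor <;> linarith [U.nonneg' z.1 z.2, U.le_one' z.1 z.2, W.nonneg' z.1 z.2,
      W.le_one' z.1 z.2]
  · rw [one_mul]
    exact measureReal_le_one

theorem exists_cutNorm_lt_of_cutDist_lt {U W : Graphon Ω} {δ : ℝ} (h : U.cutDist ν W < δ) :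
    ∃ φ : Ω ≃ᵐ Ω, MeasurePreserving φ ν ν ∧
      cutNorm ν (fun x y => U.relabel φ x y - W x y) < δ := by
  obtain ⟨_, ⟨φ, hφ, rfl⟩, hlt⟩ := exists_lt_of_csInf_lt (s := {r : ℝ | ∃ φ : Ω ≃ᵐ Ω,
    MeasurePreserving φ ν ν ∧ r = cutNorm ν (fun x y => U.relabel φ x y - W x y)})
    ⟨_, MeasurableEquiv.refl Ω, MeasurePreserving.id ν, rfl⟩ h
  exact ⟨φ, hφ, hlt⟩

theorem IsProperColoring.relabel [SFinite ν] {U : Graphon Ω} {k : ℕ} {f : Ω → Fin k}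
    (hf : U.IsProperColoring ν k f) {φ : Ω ≃ᵐ Ω} (hφ : MeasurePreserving φ ν ν) :
    (U.relabel φ).IsProperColoring ν k (f ∘ φ) := by
  have hm : Measurable (f ∘ φ) := hf.1.comp φ.measurable
  refine ⟨hm, fun i => ⟨hm (measurableSet_singleton i), ?_⟩⟩
  rw [ae_restrict_iff' ((hm (measurableSet_singleton i)).prod (hm (measurableSet_singleton i)))]
  filter_upwards [(hφ.prod hφ).quasiMeasurePreserving.ae hf.ae] with z hz hzi
  exact hz (hzi.1.trans hzi.2.symm)

/-- A coloring of a finite graph induces a coloring of its graphon representations. -/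
theorem Represents.exists_isProperColoring [SFinite ν] {U : Graphon Ω} {V : Type*} [Fintype V]
    {H : SimpleGraph V} (hU : U.Represents ν H) {k : ℕ} (hH : H.Colorable k) :
    ∃ f : Ω → Fin k, U.IsProperColoring ν k f := by
  obtain ⟨P, hPm, -, hcov, -, hP⟩ := hU
  obtain ⟨C⟩ := hH
  refine exists_isProperColoring_of_cover (fun i => ⋃ v ∈ {v | C v = i}, P v) (fun i => ?_)
    fun x => ?_
  · have hm : MeasurableSet (⋃ v ∈ {v | C v = i}, P v) :=
      MeasurableSet.biUnion (Set.to_countable _) fun v _ => hPm v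
    refine ⟨hm, ?_⟩
    rw [ae_restrict_iff' (hm.prod hm)]
    have h : ∀ u v, ∀ᵐ z ∂ν.prod ν, ¬ H.Adj u v → z ∈ P u ×ˢ P v → U z.1 z.2 = 0 := by
      intro u v
      by_cases huv : H.Adj u v
      · simp [huv]
      · have := (ae_restrict_iff' ((hPm u).prod (hPm v))).1 ((hP u v).2 huv)
        filter_upwards [this] with z hz _ using hz
    filter_upwards [ae_all_iff.2 fun u => ae_all_iff.2 (h u)] with z hz hzi
    obtain ⟨hz1, hz2⟩ := hzi
    simp only [Set.mem_iUnion] at hz1 hz2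
    obtain ⟨u, hu, hzu⟩ := hz1
    obtain ⟨v, hv, hzv⟩ := hz2
    exact hz u v (fun hadj => C.valid hadj (hu.trans hv.symm)) ⟨hzu, hzv⟩
  · obtain ⟨v, hv⟩ := Set.mem_iUnion.1 (hcov ▸ Set.mem_univ x : x ∈ ⋃ v, P v)
    exact ⟨C v, Set.mem_biUnion (show v ∈ {w | C w = C v} from rfl) hv⟩

theorem chromaticNumber_le_liminf [IsProbabilityMeasure ν] (W : Graphon Ω) (V : ℕ → Type*)
    [∀ n, Fintype (V n)] (H : ∀ n, SimpleGraph (V n)) (U : ℕ → Graphon Ω)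
    (hU : ∀ n, (U n).Represents ν (H n))
    (hconv : Tendsto (fun n => (U n).cutDist ν W) atTop (𝓝 0)) :
    W.chromaticNumber ν ≤ liminf (fun n => (H n).chromaticNumber) atTop := by
  by_contra! hlt
  obtain ⟨k, hk⟩ := ENat.ne_top_iff_exists.1 hlt.ne_top
  have hfreq : ∃ᶠ n in atTop, (H n).Colorable k := by
    have h1 : liminf (fun n => (H n).chromaticNumber) atTop < ((k + 1 : ℕ) : ℕ∞) := by
      rw [← hk]; exact_mod_cast Nat.lt_succ_self k
    refine (frequently_lt_of_liminf_lt (by isBoundedDefault) h1).mono fun n hn => ?_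
    rw [← SimpleGraph.chromaticNumber_le_iff_colorable]
    push_cast at hn
    exact Order.le_of_lt_add_one hn
  have : ∃ f : Ω → Fin k, W.IsProperColoring ν k f := by
    refine exists_isProperColoring_of_approx fun δ hδ => ?_
    obtain ⟨n, hcol, hn⟩ := (hfreq.and_eventually (hconv.eventually_lt_const hδ)).exists
    obtain ⟨φ, hφ, hcut⟩ := exists_cutNorm_lt_of_cutDist_lt hn
    obtain ⟨g, hg⟩ := (hU n).exists_isProperColoring hcol
    have hg' := hg.relabel hφ
    refine ⟨g ∘ φ, hg'.1, fun i => ?_⟩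
    have hle := abs_setIntegral_sub_le_cutNorm (ν := ν) ((U n).relabel φ) W (hg'.2 i).1 (hg'.2 i).1
    -- The relabeled representation vanishes on the square of a color class, so testing the cut-norm
    -- there leaves only the mass of `W`.
    have heq : ∫ z in ((g ∘ φ) ⁻¹' {i}) ×ˢ ((g ∘ φ) ⁻¹' {i}),
        ((U n).relabel φ z.1 z.2 - W z.1 z.2) ∂(ν.prod ν) =
        - ∫ z in ((g ∘ φ) ⁻¹' {i}) ×ˢ ((g ∘ φ) ⁻¹' {i}), W z.1 z.2 ∂(ν.prod ν) := by
      rw [← integral_neg]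
      refine integral_congr_ae ?_
      filter_upwards [(hg'.2 i).2] with z hz
      rw [hz, zero_sub]
    rw [heq, abs_neg] at hle
    exact (le_abs_self _).trans (hle.trans hcut.le)
  obtain ⟨f, hf⟩ := this
  exact absurd (chromaticNumber_le hf) (by rw [hk]; exact hlt.not_ge)

end CutDistance

end Graphon

/-! ### Product measures and tuples of random points. -/

section ProductMeasures

/-- Selecting coordinates along an injection preserves powers of a probability measure. -/
theorem measurePreserving_pi_comp_injective {α β X : Type*} [Fintype α] [Fintype β]
    [MeasurableSpace X] (μ : Measure X) [IsProbabilityMeasure μ] {g : α → β}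
    (hg : Function.Injective g) :
    MeasurePreserving (fun x : β → X => x ∘ g) (Measure.pi fun _ => μ) (Measure.pi fun _ => μ) := by
  have hm : Measurable (fun x : β → X => x ∘ g) :=
    measurable_pi_lambda _ fun a => measurable_pi_apply (g a)
  refine ⟨hm, (Measure.pi_eq fun t ht => ?_).symm⟩
  rw [Measure.map_apply hm (MeasurableSet.univ_pi ht)]
  have hpre : (fun x : β → X => x ∘ g) ⁻¹' Set.univ.pi t =
      Set.univ.pi fun b => {y | ∀ a, g a = b → y ∈ t a} := by
    ext x
    simp only [Set.mem_preimage, Set.mem_univ_pi, Function.comp_apply]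
    exact ⟨fun h b a hab => hab ▸ h a, fun h a => h (g a) a rfl⟩
  rw [hpre, Measure.pi_pi]
  -- Coordinates outside the range of `g` are unconstrained and contribute the factor 1.
  refine (Fintype.prod_of_injective g hg _ _ (fun b hb => ?_) fun a => ?_).symm
  · convert measure_univ (μ := μ)
    exact Set.eq_univ_of_forall fun y a hab => absurd ⟨a, hab⟩ hb
  · congr 1
    ext y
    exact ⟨fun h a' haa => hg haa ▸ h, fun h => h a rfl⟩

theorem measurePreserving_pi_curry_injective {α β γ X : Type*} [Fintype α] [Fintype β] [Fintype γ]
    [MeasurableSpace X] (μ : Measure X) [IsProbabilityMeasure μ] {g : α × γ → β}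
    (hg : Function.Injective g) :
    MeasurePreserving (fun (x : β → X) a c => x (g (a, c))) (Measure.pi fun _ => μ)
      (Measure.pi fun _ => Measure.pi fun _ => μ) := by
  have hcurry : MeasurePreserving (MeasurableEquiv.curry α γ X)
      (Measure.pi fun _ => μ) (Measure.pi fun _ => Measure.pi fun _ => μ) := by
    refine ⟨(MeasurableEquiv.curry α γ X).measurable, ?_⟩
    simp_rw [← Measure.infinitePi_eq_pi]
    exact Measure.infinitePi_map_curry fun _ _ => μ
  exact hcurry.comp (measurePreserving_pi_comp_injective μ hg)

theorem measurePreserving_pi_eval_pair {ι X : Type*} [Fintype ι] [MeasurableSpace X]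
    (μ : ι → Measure X) [∀ i, IsProbabilityMeasure (μ i)] {i j : ι} (hij : i ≠ j) :
    MeasurePreserving (fun x : ι → X => (x i, x j)) (Measure.pi μ) ((μ i).prod (μ j)) := by
  refine ⟨(measurable_pi_apply i).prodMk (measurable_pi_apply j), ?_⟩
  have h := (iIndepFun_pi (μ := μ) (X := fun _ => id) fun _ => aemeasurable_id).indepFun hij
  replace h := (indepFun_iff_map_prod_eq_prod_map_map (measurable_pi_apply i).aemeasurable
    (measurable_pi_apply j).aemeasurable).1 h
  rw [← (measurePreserving_eval μ i).map_eq, ← (measurePreserving_eval μ j).map_eq]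
  exact h

/-- The conditioned product is a multiple of the power of `μ` restricted to a box. -/
theorem pi_cond_absolutelyContinuous {ι X : Type*} [Fintype ι] [MeasurableSpace X]
    (μ : Measure X) [IsProbabilityMeasure μ] (B : ι → Set X) (hB0 : ∀ i, μ (B i) ≠ 0) :
    Measure.pi (fun i => cond μ (B i)) ≪ Measure.pi fun _ => μ := by
  have hprob : ∀ i, IsProbabilityMeasure (cond μ (B i)) := fun i =>
    cond_isProbabilityMeasure (hB0 i)
  have heq : Measure.pi (fun i => cond μ (B i)) =
      (∏ i, (μ (B i))⁻¹) • Measure.pi fun i => μ.restrict (B i) := by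
    refine Measure.pi_eq fun s hs => ?_
    simp [Measure.pi_pi, ProbabilityTheory.cond, Finset.prod_mul_distrib]
  rw [heq, ← Measure.restrict_pi_pi]
  exact (Measure.smul_absolutelyContinuous).trans Measure.restrict_le_self.absolutelyContinuous

/-- If `E` nearly fills the products `B i × B j` of the related pairs `i, j`, then almost every
property of tuples holds for a tuple whose related pairs of coordinates all lie in `E`. -/
theorem exists_forall_mem_of_ae_pi {ι X : Type*} [Fintype ι] [MeasurableSpace X] (μ : Measure X)
    [IsProbabilityMeasure μ] {E : Set (X × X)} (hE : MeasurableSet E) (B : ι → Set X)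
    (hB0 : ∀ i, μ (B i) ≠ 0) (R : ι → ι → Prop)
    (hR : ∀ i j, R i j → i ≠ j) {ε : ENNReal} (hε : (Fintype.card (ι × ι)) * ε < 1)
    (hdens : ∀ i j, R i j → (μ.prod μ) (Eᶜ ∩ B i ×ˢ B j) ≤ ε * (μ (B i) * μ (B j)))
    {p : (ι → X) → Prop} (hp : ∀ᵐ y ∂Measure.pi fun _ : ι => μ, p y) :
    ∃ y, p y ∧ ∀ i j, R i j → (y i, y j) ∈ E := by
  classical
  have hprob : ∀ i, IsProbabilityMeasure (cond μ (B i)) := fun i =>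
    cond_isProbabilityMeasure (hB0 i)
  -- Draw the coordinates independently, the `i`-th from `μ` conditioned on `B i`. Each related pair
  -- misses `E` with probability at most `ε`, so a union bound leaves a good tuple.
  set κ := Measure.pi fun i => cond μ (B i) with hκ
  have hp' : ∀ᵐ y ∂κ, p y := (pi_cond_absolutelyContinuous μ B hB0).ae_le hp
  set bad : ι × ι → Set (ι → X) := fun q => {y | R q.1 q.2 ∧ (y q.1, y q.2) ∉ E} with hbad
  have hle : ∀ q, κ (bad q) ≤ ε := by
    rintro ⟨i, j⟩
    by_cases hij : R i j
    · have hmp := measurePreserving_pi_eval_pair (fun i => cond μ (B i)) (hR i j hij)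
      have : bad (i, j) = (fun x : ι → X => (x i, x j)) ⁻¹' Eᶜ := by
        ext y; simp [hbad, hij]
      rw [this, hmp.measure_preimage hE.compl.nullMeasurableSet]
      have hc : (cond μ (B i)).prod (cond μ (B j)) Eᶜ =
          (μ (B i))⁻¹ * (μ (B j))⁻¹ * (μ.prod μ) (Eᶜ ∩ B i ×ˢ B j) := by
        rw [ProbabilityTheory.cond, ProbabilityTheory.cond, Measure.prod_smul_left,
          Measure.prod_smul_right, Measure.prod_restrict, Measure.smul_apply, Measure.smul_apply,
          Measure.restrict_apply hE.compl, smul_eq_mul, smul_eq_mul, mul_assoc]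
      rw [hc]
      calc (μ (B i))⁻¹ * (μ (B j))⁻¹ * (μ.prod μ) (Eᶜ ∩ B i ×ˢ B j)
          ≤ (μ (B i))⁻¹ * (μ (B j))⁻¹ * (ε * (μ (B i) * μ (B j))) := by
            gcongr; exact hdens i j hij
        _ = ε * ((μ (B i))⁻¹ * μ (B i)) * ((μ (B j))⁻¹ * μ (B j)) := by ring
        _ = ε := by
            rw [ENNReal.inv_mul_cancel (hB0 i) (measure_ne_top _ _),
              ENNReal.inv_mul_cancel (hB0 j) (measure_ne_top _ _), mul_one, mul_one]
    · have : bad (i, j) = ∅ := by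
        ext y; simp [hbad, hij]
      simp [this]
  have hunion : κ (⋃ q, bad q) < 1 := by
    refine ((measure_iUnion_fintype_le κ bad).trans (Finset.sum_le_sum fun q _ => hle q)).trans_lt ?_
    simpa [Finset.sum_const, nsmul_eq_mul] using hε
  have hnot : ¬ ∀ᵐ y ∂κ, y ∈ ⋃ q, bad q := by
    intro h
    have huniv : κ (⋃ q, bad q) = κ Set.univ := measure_congr (eventuallyEq_univ.2 h)
    rw [huniv, measure_univ] at hunion
    exact lt_irrefl _ hunion
  have hfreq : ∃ᶠ y in ae κ, y ∉ ⋃ q, bad q := not_eventually.1 hnot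
  obtain ⟨y, hy, hpy⟩ := (hfreq.and_eventually hp').exists
  refine ⟨y, hpy, fun i j hij => ?_⟩
  by_contra hE'
  exact hy (Set.mem_iUnion.2 ⟨(i, j), hij, hE'⟩)

end ProductMeasures

namespace Graphon

/-! ### Colorability of random samples. -/

section RandomGraphs

variable {Ω : Type*} [MeasurableSpace Ω] {ν : Measure Ω}

theorem measurableSet_simpleGraph {n : ℕ} (s : Set (SimpleGraph (Fin n))) : MeasurableSet s := by
  have hsing : ∀ G₀ : SimpleGraph (Fin n), MeasurableSet ({G₀} : Set (SimpleGraph (Fin n))) := by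
    intro G₀
    have : ({G₀} : Set (SimpleGraph (Fin n))) = ⋂ u, ⋂ v, {G | G.Adj u v ↔ G₀.Adj u v} := by
      ext G
      simp only [Set.mem_singleton_iff, Set.mem_iInter, Set.mem_ofPred_eq]
      exact ⟨fun h u v => by rw [h], fun h => by ext u v; exact h u v⟩
    rw [this]
    refine MeasurableSet.iInter fun u => MeasurableSet.iInter fun v => ?_
    have hadj : Measurable fun G : SimpleGraph (Fin n) => G.Adj u v :=
      SimpleGraph.measurable_iff_adj.1 measurable_id u v
    exact measurableSet_setOfPred.2 (hadj.iff measurable_const)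
  rw [← Set.biUnion_of_singleton s]
  exact MeasurableSet.biUnion (Set.to_countable s) fun G _ => hsing G

theorem randomGraphLaw_apply (W : Graphon Ω) {n : ℕ} (s : Set (SimpleGraph (Fin n))) :
    W.randomGraphLaw ν n s = ((Measure.pi fun _ : Fin n => ν).prod
      (Measure.pi fun _ : Sym2 (Fin n) => (volume : Measure unitInterval)))
      {p | W.sampleGraph p.1 p.2 ∈ s} :=
  Measure.map_apply (W.measurable_sampleGraph n) (measurableSet_simpleGraph s)

/-- A proper coloring of `W` almost surely induces a proper coloring of its samples. -/
theorem IsProperColoring.randomGraphLaw [IsProbabilityMeasure ν] {W : Graphon Ω} {k : ℕ}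
    {f : Ω → Fin k} (hf : W.IsProperColoring ν k f) (n : ℕ) :
    ∀ᵐ G ∂W.randomGraphLaw ν n, G.Colorable k := by
  rw [ae_iff, randomGraphLaw_apply]
  change ∀ᵐ p ∂(Measure.pi fun _ : Fin n => ν).prod
    (Measure.pi fun _ : Sym2 (Fin n) => (volume : Measure unitInterval)),
    (W.sampleGraph p.1 p.2).Colorable k
  have h : ∀ᵐ x ∂Measure.pi fun _ : Fin n => ν,
      ∀ i j, i ≠ j → f (x i) = f (x j) → W (x i) (x j) = 0 := by
    refine ae_all_iff.2 fun i => ae_all_iff.2 fun j => ?_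
    by_cases hij : i = j
    · simp [hij]
    · filter_upwards [(measurePreserving_pi_eval_pair (fun _ : Fin n => ν)
        hij).quasiMeasurePreserving.ae hf.ae] with x hx _ using hx
  filter_upwards [Measure.quasiMeasurePreserving_fst.ae h] with p hp
  refine ⟨SimpleGraph.Coloring.mk (fun i => f (p.1 i)) fun {i j} hij hcol => ?_⟩
  have hlt := hij.2
  rw [hp i j hij.1 hcol] at hlt
  exact absurd hlt (not_lt.2 (p.2 s(i, j)).2.1)

/-- Disjoint blocks of `m` vertices span independent copies of the `m`-sample, and each must be
`k`-colorable. The injections `g` and `g'` select the points and edge labels of the blocks. -/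
theorem randomGraphLaw_colorable_le_pow [IsProbabilityMeasure ν] (W : Graphon Ω) (k : ℕ)
    {m B n : ℕ} (hn : B * m ≤ n) :
    W.randomGraphLaw ν n {G | G.Colorable k} ≤ (W.randomGraphLaw ν m {G | G.Colorable k}) ^ B := by
  set g : Fin B × Fin m → Fin n := fun q => Fin.castLE hn (finProdFinEquiv q) with hg
  have hginj : Function.Injective g :=
    (Fin.castLE_injective hn).comp finProdFinEquiv.injective
  set g' : Fin B × Sym2 (Fin m) → Sym2 (Fin n) := fun q => q.2.map fun j => g (q.1, j) with hg'
  have hrow : ∀ b, Function.Injective fun j => g (b, j) := fun b j j' h =>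
    (Prod.ext_iff.1 (hginj h)).2
  have hg'inj : Function.Injective g' := by
    rintro ⟨b, e⟩ ⟨b', e'⟩ h
    have hb : b = b' := by
      induction e using Sym2.ind with | _ i j
      induction e' using Sym2.ind with | _ i' j'
      simp only [hg', Sym2.map_mk, Sym2.eq_iff] at h
      rcases h with h | h
      · exact (Prod.ext_iff.1 (hginj h.1)).1
      · exact (Prod.ext_iff.1 (hginj h.1)).1
    subst hb
    exact Prod.ext rfl (Sym2.map.injective (hrow b) h)
  have hmp := (measurePreserving_arrowProdEquivProdArrow (Fin m → Ω)
    (Sym2 (Fin m) → unitInterval) (Fin B) (fun _ => Measure.pi fun _ => ν)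
    (fun _ => Measure.pi fun _ => volume)).symm.comp
    ((measurePreserving_pi_curry_injective ν hginj).prod
      (measurePreserving_pi_curry_injective (volume : Measure unitInterval) hg'inj))
  rw [randomGraphLaw_apply, randomGraphLaw_apply]
  set A : Set ((Fin m → Ω) × (Sym2 (Fin m) → unitInterval)) :=
    {p | W.sampleGraph p.1 p.2 ∈ {G | G.Colorable k}} with hA
  have hAm : MeasurableSet A := W.measurable_sampleGraph m (measurableSet_simpleGraph _)
  have hpow := hmp.measure_preimage (MeasurableSet.univ_pi fun _ : Fin B => hAm).nullMeasurableSet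
  rw [Measure.pi_pi, Finset.prod_const, Finset.card_univ, Fintype.card_fin] at hpow
  rw [← hpow]
  refine measure_mono fun p hp b _ => ?_
  obtain ⟨C⟩ := hp
  refine ⟨SimpleGraph.Coloring.mk (fun j => C (g (b, j))) fun {i j} hij => C.valid ?_⟩
  exact ⟨fun h => hij.1 (hrow b h), hij.2⟩

/-- If all samples of `W` are almost surely `k`-colorable, then so are the graphs that `{W > 0}`
spans on random points. -/
theorem ae_colorable_of_randomGraphLaw [IsProbabilityMeasure ν] {W : Graphon Ω} {k m : ℕ}
    (h : ∀ᵐ G ∂W.randomGraphLaw ν m, G.Colorable k) :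
    ∀ᵐ x ∂Measure.pi fun _ : Fin m => ν,
      ∃ c : Fin m → Fin k, ∀ i j, i ≠ j → 0 < W (x i) (x j) → c i ≠ c j := by
  rw [ae_iff, randomGraphLaw_apply] at h
  have h' : ∀ᵐ p ∂(Measure.pi fun _ : Fin m => ν).prod
    (Measure.pi fun _ : Sym2 (Fin m) => (volume : Measure unitInterval)),
    (W.sampleGraph p.1 p.2).Colorable k := h
  filter_upwards [Measure.ae_ae_of_ae_prod h'] with x hx
  obtain ⟨δ, hδ0, hδ⟩ : ∃ δ : ℝ, 0 < δ ∧ ∀ i j, 0 < W (x i) (x j) → δ < W (x i) (x j) := by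
    have hev : ∀ᶠ δ in 𝓝[>] (0 : ℝ), ∀ i j, 0 < W (x i) (x j) → δ < W (x i) (x j) := by
      refine eventually_all.2 fun i => eventually_all.2 fun j => ?_
      by_cases hij : 0 < W (x i) (x j)
      · filter_upwards [Ioo_mem_nhdsGT hij] with δ hδ _ using hδ.2
      · simp [hij]
    obtain ⟨δ, hδ, hδ0⟩ := (hev.and self_mem_nhdsWithin).exists
    exact ⟨δ, hδ0, hδ⟩
  have hvol : (volume : Measure unitInterval) {s | (s : ℝ) < δ} ≠ 0 := by
    have hmem : min δ 1 ∈ unitInterval := ⟨(lt_min hδ0 one_pos).le, min_le_right _ _⟩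
    refine ne_of_gt (lt_of_lt_of_le ?_ (measure_mono (s := Set.Iio ⟨min δ 1, hmem⟩) fun s hs => ?_))
    · rw [unitInterval.volume_Iio, ENNReal.ofReal_pos]
      exact lt_min hδ0 one_pos
    · exact lt_of_lt_of_le (show (s : ℝ) < min δ 1 from hs) (min_le_left _ _)
  -- With positive probability all labels lie below `δ`; the sample then contains every pair with `W
  -- > 0`.
  have hpos : (Measure.pi fun _ : Sym2 (Fin m) => (volume : Measure unitInterval))
      {t | ∀ e, (t e : ℝ) < δ} ≠ 0 := by
    have : {t : Sym2 (Fin m) → unitInterval | ∀ e, (t e : ℝ) < δ} =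
        Set.univ.pi fun _ => {s : unitInterval | (s : ℝ) < δ} := by
      ext t; simp
    rw [this, Measure.pi_pi]
    exact Finset.prod_ne_zero_iff.2 fun _ _ => hvol
  obtain ⟨t, ht, C⟩ := ((frequently_ae_iff.2 hpos).and_eventually hx).exists
  obtain ⟨C⟩ := C
  exact ⟨C, fun i j hij hW => C.valid ⟨hij, (ht _).trans (hδ i j hW)⟩⟩

end RandomGraphs

end Graphon

/-! ### Lebesgue density in products of balls. -/

section DensityPoints

variable {Ω : Type*} [MeasurableSpace Ω] [StandardBorelSpace Ω]

/-- The pullback to `Ω` of a closed ball under an embedding of `Ω` into the real line. -/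
noncomputable def realBall (x : Ω) (r : ℝ) : Set Ω :=
  embeddingReal Ω ⁻¹' Metric.closedBall (embeddingReal Ω x) r

theorem measurableSet_realBall (x : Ω) (r : ℝ) : MeasurableSet (realBall x r) :=
  (measurableEmbedding_embeddingReal Ω).measurable measurableSet_closedBall

/-- `z` is a point of density of `E`, with respect to products of two balls of equal radius. -/
def IsDensityPoint (ν : Measure Ω) (E : Set (Ω × Ω)) (z : Ω × Ω) : Prop :=
  Tendsto (fun r => (ν.prod ν) (E ∩ realBall z.1 r ×ˢ realBall z.2 r) /
    (ν.prod ν) (realBall z.1 r ×ˢ realBall z.2 r)) (𝓝[>] 0) (𝓝 1)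

/-- Besicovitch's density theorem in `ℝ × ℝ` is pulled back along the embedding; closed balls of the
sup metric are products of intervals. -/
theorem ae_isDensityPoint (ν : Measure Ω) [IsFiniteMeasure ν] {E : Set (Ω × Ω)}
    (hE : MeasurableSet E) : ∀ᵐ z ∂ν.prod ν, z ∈ E → IsDensityPoint ν E z := by
  set e : Ω × Ω → ℝ × ℝ := Prod.map (embeddingReal Ω) (embeddingReal Ω) with he
  have hemb : MeasurableEmbedding e :=
    (measurableEmbedding_embeddingReal Ω).prodMap (measurableEmbedding_embeddingReal Ω)
  have hae := ae_of_ae_map hemb.measurable.aemeasurable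
    (Besicovitch.ae_tendsto_measure_inter_div_of_measurableSet ((ν.prod ν).map e)
      (hemb.measurableSet_image' hE))
  filter_upwards [hae] with z hz hzE
  rw [Set.indicator_of_mem (Set.mem_image_of_mem e hzE)] at hz
  have hball : ∀ r, e ⁻¹' Metric.closedBall (e z) r = realBall z.1 r ×ˢ realBall z.2 r := by
    intro r
    rw [← closedBall_prod_same]
    rfl
  refine hz.congr fun r => ?_
  rw [hemb.map_apply, hemb.map_apply, Set.preimage_inter, hemb.injective.preimage_image, hball]

theorem IsDensityPoint.eventually {ν : Measure Ω} [IsFiniteMeasure ν] {E : Set (Ω × Ω)}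
    (hE : MeasurableSet E) {z : Ω × Ω} (hz : IsDensityPoint ν E z) {ε : ENNReal} (hε : ε ≠ 0) :
    ∀ᶠ r in 𝓝[>] (0 : ℝ), ν (realBall z.1 r) ≠ 0 ∧ ν (realBall z.2 r) ≠ 0 ∧
      (ν.prod ν) (Eᶜ ∩ realBall z.1 r ×ˢ realBall z.2 r) ≤
        ε * (ν (realBall z.1 r) * ν (realBall z.2 r)) := by
  have hlt : 1 - ε < 1 := ENNReal.sub_lt_self ENNReal.one_ne_top one_ne_zero hε
  filter_upwards [hz.eventually_const_lt hlt] with r hr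
  set b := realBall z.1 r ×ˢ realBall z.2 r with hb
  have hbm : MeasurableSet b := (measurableSet_realBall _ _).prod (measurableSet_realBall _ _)
  have hprod : (ν.prod ν) b = ν (realBall z.1 r) * ν (realBall z.2 r) := Measure.prod_prod _ _
  have hb0 : (ν.prod ν) b ≠ 0 := by
    -- On a null product the density ratio is `0 / 0 = 0`, which cannot exceed `1 - ε`.
    intro h0
    rw [measure_mono_null Set.inter_subset_right h0, ENNReal.zero_div] at hr
    exact not_lt_bot hr
  rw [ENNReal.lt_div_iff_mul_lt (Or.inl hb0) (Or.inl (measure_ne_top _ _))] at hr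
  rw [← hprod]
  rw [hprod] at hb0
  refine ⟨left_ne_zero_of_mul hb0, right_ne_zero_of_mul hb0, ?_⟩
  have hsplit : (ν.prod ν) (E ∩ b) + (ν.prod ν) (Eᶜ ∩ b) = (ν.prod ν) b := by
    rw [Set.inter_comm E, Set.inter_comm Eᶜ]
    exact measure_inter_add_sdiff b hE
  have hone : (1 : ENNReal) ≤ (1 - ε) + ε := le_tsub_add
  refine (ENNReal.add_le_add_iff_left (measure_ne_top (ν.prod ν) (E ∩ b))).1 ?_
  calc (ν.prod ν) (E ∩ b) + (ν.prod ν) (Eᶜ ∩ b) = 1 * (ν.prod ν) b := by rw [hsplit, one_mul]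
    _ ≤ ((1 - ε) + ε) * (ν.prod ν) b := by gcongr
    _ = (1 - ε) * (ν.prod ν) b + ε * (ν.prod ν) b := add_mul _ _ _
    _ ≤ (ν.prod ν) (E ∩ b) + ε * (ν.prod ν) b := by gcongr

end DensityPoints

namespace Graphon

/-! ### The coloring of `Ω` by compactness, and part (b). -/

section LowerBound

variable {Ω : Type*} [MeasurableSpace Ω] [StandardBorelSpace Ω] {ν : Measure Ω}

/-- If the graphs that `{W > 0}` spans on finitely many random points are almost surely
`k`-colorable, then every finite family of points, joined where `{W > 0}` has a point of density,
is `k`-colorable. -/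
theorem exists_coloring_of_finite [IsProbabilityMeasure ν] {W : Graphon Ω} {k : ℕ}
    (h : ∀ m, ∀ᵐ x ∂Measure.pi fun _ : Fin m => ν,
      ∃ c : Fin m → Fin k, ∀ i j, i ≠ j → 0 < W (x i) (x j) → c i ≠ c j)
    {m : ℕ} (x : Fin m → Ω) :
    ∃ c : Fin m → Fin k, ∀ i j, x i ≠ x j →
      IsDensityPoint ν {z : Ω × Ω | 0 < W z.1 z.2} (x i, x j) → c i ≠ c j := by
  classical
  have hE : MeasurableSet {z : Ω × Ω | 0 < W z.1 z.2} :=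
    measurableSet_lt measurable_const W.measurable_uncurry
  set E := {z : Ω × Ω | 0 < W z.1 z.2} with hEdef
  -- The union bound over `m²` pairs then totals `m² / (m² + 1) < 1`.
  set ε : ENNReal := ((Fintype.card (Fin m × Fin m) : ENNReal) + 1)⁻¹ with hεdef
  have hε0 : ε ≠ 0 := ENNReal.inv_ne_zero.2 (by finiteness)
  have hε : (Fintype.card (Fin m × Fin m)) * ε < 1 := by
    rw [hεdef, ← div_eq_mul_inv]
    refine ENNReal.div_lt_of_lt_mul ?_
    rw [one_mul]
    exact ENNReal.lt_add_right (by finiteness) one_ne_zero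
  set R : Fin m → Fin m → Prop := fun i j => x i ≠ x j ∧ IsDensityPoint ν E (x i, x j) with hR
  obtain ⟨r, hr⟩ : ∃ r, ∀ i j, R i j → ν (realBall (x i) r) ≠ 0 ∧ ν (realBall (x j) r) ≠ 0 ∧
      (ν.prod ν) (Eᶜ ∩ realBall (x i) r ×ˢ realBall (x j) r) ≤
        ε * (ν (realBall (x i) r) * ν (realBall (x j) r)) := by
    refine Eventually.exists (f := 𝓝[>] (0 : ℝ))
      (eventually_all.2 fun i => eventually_all.2 fun j => ?_)
    by_cases hij : R i j
    · filter_upwards [hij.2.eventually hE hε0] with r hr _ using hr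
    · simp [hij]
  -- Points in a related pair have balls of positive measure; `Set.univ` is a default for null
  -- balls, so that conditioning makes sense.
  set B : Fin m → Set Ω := fun i =>
    if ν (realBall (x i) r) = 0 then Set.univ else realBall (x i) r with hB
  obtain ⟨y, ⟨c, hc⟩, hy⟩ := exists_forall_mem_of_ae_pi ν hE B
    (fun i => by
      simp only [hB]; split_ifs with h0
      exacts [by simp, h0])
    R (fun i j hij hij' => hij.1 (congrArg x hij')) hε
    (fun i j hij => by
      obtain ⟨h1, h2, h3⟩ := hr i j hij
      simpa only [hB, if_neg h1, if_neg h2] using h3) (h m)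
  exact ⟨c, fun i j hij hd => hc i j (fun h' => hij (congrArg x h')) (hy i j ⟨hij, hd⟩)⟩

theorem exists_isProperColoring_of_ae_colorable [IsProbabilityMeasure ν] [NullSingletonClass ν]
    {W : Graphon Ω} {k : ℕ}
    (h : ∀ m, ∀ᵐ G ∂W.randomGraphLaw ν m, G.Colorable k) :
    ∃ f : Ω → Fin k, W.IsProperColoring ν k f := by
  set E : Set (Ω × Ω) := {z | 0 < W z.1 z.2} with hEdef
  have hE : MeasurableSet E := measurableSet_lt measurable_const W.measurable_uncurry
  let Γ : SimpleGraph Ω :=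
    { Adj := fun x y => x ≠ y ∧ IsDensityPoint ν E (x, y) ∧ IsDensityPoint ν E (y, x)
      symm := ⟨fun _ _ hxy => ⟨hxy.1.symm, hxy.2.2, hxy.2.1⟩⟩
      loopless := ⟨fun _ hx => hx.1 rfl⟩ }
  obtain ⟨c⟩ : Nonempty (Γ →g (⊤ : SimpleGraph (Fin k))) := by
    -- The de Bruijn-Erdős theorem, with colorings as homomorphisms into the complete graph.
    refine SimpleGraph.nonempty_hom_of_forall_finite_subgraph_hom fun G' hG' => ?_
    have := hG'.fintype
    refine Classical.choice ?_
    let e := (Fintype.equivFin G'.verts).symm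
    obtain ⟨c, hc⟩ := exists_coloring_of_finite (fun m => ae_colorable_of_randomGraphLaw (h m))
      (fun i => (e i : Ω))
    refine ⟨⟨fun v => c (e.symm v), fun {u v} huv => ?_⟩⟩
    have hΓ : Γ.Adj u v := G'.adj_sub huv
    have := hc (e.symm u) (e.symm v)
    simp only [Equiv.apply_symm_apply] at this
    exact this hΓ.1 hΓ.2.1
  refine exists_isProperColoring_of_ae c ?_
  have hd := ae_isDensityPoint ν hE
  -- `Γ` has no loops, so its coloring says nothing on the diagonal, which is null because `ν` has
  -- no atoms.
  have hne : ∀ᵐ z ∂ν.prod ν, z.1 ≠ z.2 := by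
    obtain ⟨e, he⟩ := exists_measurableEmbedding_real Ω
    have hdiag : MeasurableSet {z : Ω × Ω | e z.1 = e z.2} :=
      measurableSet_eq_fun (he.measurable.comp measurable_fst) (he.measurable.comp measurable_snd)
    rw [ae_iff]
    have heq : {z : Ω × Ω | ¬ z.1 ≠ z.2} = {z | e z.1 = e z.2} := by
      ext z; simp [he.injective.eq_iff]
    rw [heq, Measure.measure_prod_null hdiag]
    refine ae_of_all _ fun x => ?_
    have : Prod.mk x ⁻¹' {z : Ω × Ω | e z.1 = e z.2} = {x} := by
      ext y; simp [he.injective.eq_iff, eq_comm]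
    exact (congrArg ν this).trans (measure_singleton x)
  filter_upwards [hd, Measure.measurePreserving_swap.quasiMeasurePreserving.ae hd, hne]
    with z hz hz' hzne hcz
  by_contra hW
  have hpos : 0 < W z.1 z.2 := lt_of_le_of_ne (W.nonneg' _ _) (Ne.symm hW)
  have hpos' : z.swap ∈ E := by
    change 0 < W z.2 z.1
    rwa [W.symm']
  have hadj : Γ.Adj z.1 z.2 := ⟨hzne, hz hpos, hz' hpos'⟩
  exact c.map_adj hadj hcz

/-- Division with remainder makes this `m` copies of a geometric series. -/
theorem tsum_pow_div_ne_top {q : ENNReal} (hq : q < 1) {m : ℕ} (hm : m ≠ 0) :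
    ∑' n : ℕ, q ^ (n / m) ≠ ⊤ := by
  have : NeZero m := ⟨hm⟩
  have heq : ∑' n : ℕ, q ^ (n / m) = ∑' p : ℕ × Fin m, q ^ p.1 :=
    (Nat.divModEquiv m).tsum_eq fun p : ℕ × Fin m => q ^ p.1
  rw [heq, ENNReal.tsum_prod']
  simp only [tsum_fintype, Finset.sum_const, Finset.card_univ, Fintype.card_fin, nsmul_eq_mul]
  rw [ENNReal.tsum_mul_left, ENNReal.tsum_geometric]
  exact ENNReal.mul_ne_top (by finiteness) (ENNReal.inv_ne_top.2 (tsub_pos_of_lt hq).ne')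

theorem ae_eventually_not_colorable [IsProbabilityMeasure ν] [NullSingletonClass ν]
    {W : Graphon Ω} {k : ℕ} (hk : (k : ℕ∞) < W.chromaticNumber ν) {Ω' : Type*}
    [MeasurableSpace Ω'] {P : Measure Ω'} {G : ∀ n : ℕ, Ω' → SimpleGraph (Fin n)}
    (hG : ∀ n, HasLaw (G n) (W.randomGraphLaw ν n) P) :
    ∀ᵐ ω ∂P, ∀ᶠ n in atTop, ¬ (G n ω).Colorable k := by
  obtain ⟨m, hm⟩ : ∃ m, ¬ ∀ᵐ H ∂W.randomGraphLaw ν m, H.Colorable k := by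
    by_contra! hall
    obtain ⟨f, hf⟩ := exists_isProperColoring_of_ae_colorable hall
    exact hk.not_ge (chromaticNumber_le hf)
  have hm0 : m ≠ 0 := by
    rintro rfl
    exact hm (ae_of_all _ fun H => SimpleGraph.Colorable.of_isEmpty k)
  have hq : W.randomGraphLaw ν m {H | H.Colorable k} < 1 := by
    refine lt_of_le_of_ne prob_le_one fun h1 => hm ?_
    exact (mem_ae_iff_prob_eq_one (measurableSet_simpleGraph _)).2 h1
  refine ae_eventually_notMem (s := fun n => {ω | (G n ω).Colorable k})
    (ne_top_of_le_ne_top (tsum_pow_div_ne_top hq hm0) (ENNReal.tsum_le_tsum fun n => ?_))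
  rw [(hG n).measure_eq (p := fun H => H.Colorable k) (measurableSet_simpleGraph _)]
  exact W.randomGraphLaw_colorable_le_pow k (Nat.div_mul_le_self n m)

theorem ae_tendsto_chromaticNumber [IsProbabilityMeasure ν] [NullSingletonClass ν]
    (W : Graphon Ω) {Ω' : Type*} [MeasurableSpace Ω'] {P : Measure Ω'}
    {G : ∀ n : ℕ, Ω' → SimpleGraph (Fin n)}
    (hG : ∀ n, HasLaw (G n) (W.randomGraphLaw ν n) P) :
    ∀ᵐ ω ∂P, Tendsto (fun n => (G n ω).chromaticNumber) atTop (𝓝 (W.chromaticNumber ν)) := by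
  have hlower : ∀ᵐ ω ∂P, ∀ k : ℕ, (k : ℕ∞) < W.chromaticNumber ν →
      ∀ᶠ n in atTop, ¬ (G n ω).Colorable k := by
    refine ae_all_iff.2 fun k => ?_
    by_cases hk : (k : ℕ∞) < W.chromaticNumber ν
    · filter_upwards [ae_eventually_not_colorable hk hG] with ω hω _ using hω
    · simp [hk]
  have hupper : ∀ᵐ ω ∂P, ∀ n, (G n ω).chromaticNumber ≤ W.chromaticNumber ν := by
    refine ae_all_iff.2 fun n => ?_
    by_cases htop : W.chromaticNumber ν = ⊤
    · simp [htop]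
    · obtain ⟨k, f, hf, hk⟩ := exists_isProperColoring_of_ne_top htop
      have h0 := ae_of_ae_map (hG n).aemeasurable ((hG n).map_eq.symm ▸ hf.randomGraphLaw n)
      filter_upwards [h0] with ω hω
      rw [hk]
      exact SimpleGraph.chromaticNumber_le_iff_colorable.2 hω
  filter_upwards [hlower, hupper] with ω hl hu
  refine tendsto_order.2 ⟨fun a ha => ?_, fun b hb => Eventually.of_forall fun n =>
    (hu n).trans_lt hb⟩
  -- Any `a` below the limit is a natural number, so excluding `a`-colorings puts the chromatic
  -- number above `a`.
  obtain ⟨k, rfl⟩ := ENat.ne_top_iff_exists.1 ha.ne_top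
  filter_upwards [hl k ha] with n hn
  exact lt_of_not_ge fun hle => hn (SimpleGraph.chromaticNumber_le_iff_colorable.1 hle)

end LowerBound

end Graphon

theorem theorem4p2 {Ω : Type*} [MeasurableSpace Ω] [StandardBorelSpace Ω]
    (ν : Measure Ω) [IsProbabilityMeasure ν] [NullSingletonClass ν] (W : Graphon Ω) :
    (∀ (V : ℕ → Type*) [∀ n, Fintype (V n)] (H : ∀ n, SimpleGraph (V n)) (U : ℕ → Graphon Ω),
      (∀ n, (U n).Represents ν (H n)) →
      Tendsto (fun n => (U n).cutDist ν W) atTop (𝓝 0) →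
      W.chromaticNumber ν ≤ liminf (fun n => (H n).chromaticNumber) atTop) ∧
    (∀ (Ω' : Type*) [MeasurableSpace Ω'] (P : Measure Ω') [IsProbabilityMeasure P]
      (G : ∀ n : ℕ, Ω' → SimpleGraph (Fin n)),
      (∀ n, HasLaw (G n) (W.randomGraphLaw ν n) P) →
      ∀ᵐ ω ∂P, Tendsto (fun n => (G n ω).chromaticNumber) atTop (𝓝 (W.chromaticNumber ν))) :=
  ⟨fun V _ H U hU hconv => W.chromaticNumber_le_liminf V H U hU hconv,
    fun _ _ _ _ _ hG => W.ae_tendsto_chromaticNumber hG⟩
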